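/- **Conventions.** A differential structure on a topological space $S$ is a family $C^\infty(S)$ of real functions on $S$ such that (A1) the sets $f^{-1}((a,b))$, $f\in C^\infty(S)$, $a,b\in\mathbb R$, form a subbasis of the topology; (A2) $F(f_1,\dots,f_n)\in C^\infty(S)$ for all $f_i\in C^\infty(S)$ and $F\in C^\infty(\mathbb R^n)$; (A3) every function that locally agrees with members of $C^\infty(S)$ belongs to $C^\infty(S)$. A map $\varphi:R\to S$ of differential spaces is smooth if $f\circ\varphi\in C^\infty(R)$ for all $f\in C^\infty(S)$, and a diffeomorphism if it is bijective and $\varphi,\varphi^{-1}$ are smooth. A subset $A$ of a differential space $S$ carries the induced structure of all functions on $A$ that are, near each point of $A$, restrictions of members of $C^\infty(S)$. **Setting.** Let $G$ be a connected Lie group acting smoothly and properly on a (Hausdorff, paracompact, finite-dimensional) smooth manifold $M$, with orbit map $\pi:M\to M/G$. Put $C^\infty(M/G)=\{f\in C^0(M/G) : f\circ\pi\in C^\infty(M)\}$. For a subgroup $H\le G$ let $M_{(H)}=\{m\in M : G_m \text{ is conjugate to } H\}$, and let $P$ be a connected component of $M_{(H)}$; it is $G$-invariant. Let $\pi_P:P\to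 P/G$ be the orbit map of the restricted action, and let $\pi(P)\subseteq M/G$ carry the structure induced from $M/G$. **Proposition.** The set $\pi(P)$ is a connected component of $\pi(M_{(H)})$ (a stratum of $M/G$), the families above on $M/G$ and $\pi(P)$ are differential structures, and the map $$\Lambda: P/G\to\pi(P),\qquad \pi_P(p)\mapsto\pi(p),$$ is a well-defined bijection and a diffeomorphism of differential spaces, where $P/G$ carries the structure of all continuous $f$ such that $f\circ\pi_P$ is smooth for the structure induced on $P$ by $M$ (this is a differential structure too). Likewise, when $P$ is regarded as an embedded submanifold of $M$ and $P/G$ as the quotient manifold of $P$ (that is, for every smooth manifold structure on the space $P$ for which $P\hookrightarrow M$ is a smooth embedding and every smooth manifold structure on the space $P/G$ for which $\pi_P$ is a smooth submersion), $\Lambda$ is a diffeomorphism from $P/G$, with its smooth functions as a manifold, onto $\pi(P)$. -/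

import Mathlib

open scoped Manifold ContDiff

namespace DifferentialSpace

/-- A family `C` of real functions on a topological space `X` is a differential structure if
the preimages of open intervals form a subbasis of the topology, `C` is closed under composition
with smooth functions of several variables, and `C` contains every function that locally agrees
with members of `C`. -/
structure IsDifferentialStructure {X : Type*} [t : TopologicalSpace X] (C : Set (X → ℝ)) :
    Prop where
  subbasis : t = TopologicalSpace.generateFrom
    {s : Set X | ∃ f ∈ C, ∃ a b : ℝ, s = f ⁻¹' Set.Ioo a b}
  comp_mem : ∀ (n : ℕ) (f : Fin n → X → ℝ), (∀ i, f i ∈ C) →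
    ∀ F : (Fin n → ℝ) → ℝ, ContDiff ℝ ∞ F → (fun x => F (fun i => f i x)) ∈ C
  local_mem : ∀ f : X → ℝ,
    (∀ x : X, ∃ U : Set X, IsOpen U ∧ x ∈ U ∧ ∃ g ∈ C, Set.EqOn g f U) → f ∈ C

/-- A map is smooth if it pulls back functions of the target structure to functions of the
source structure. -/
def IsSmoothMap {R S : Type*} (CR : Set (R → ℝ)) (CS : Set (S → ℝ)) (φ : R → S) : Prop :=
  ∀ f ∈ CS, f ∘ φ ∈ CR

/-- An invertible map that is smooth together with its inverse. -/
def IsDiffeomorphism {R S : Type*} (CR : Set (R → ℝ)) (CS : Set (S → ℝ)) (φ : R ≃ S) : Prop :=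
  IsSmoothMap CR CS φ ∧ IsSmoothMap CS CR φ.symm

/-- The differential structure of a smooth manifold: the globally defined smooth functions. -/
def ofManifold {E : Type*} [NormedAddCommGroup E] [NormedSpace ℝ E] (M : Type*)
    [TopologicalSpace M] [ChartedSpace E M] : Set (M → ℝ) :=
  {f | ContMDiff 𝓘(ℝ, E) 𝓘(ℝ, ℝ) ∞ f}

/-- The structure induced on a subset: functions that are locally restrictions of members
of `C`. -/
def restrict {X : Type*} [TopologicalSpace X] (C : Set (X → ℝ)) (S : Set X) : Set (S → ℝ) :=
  {f | ∀ x : S, ∃ U : Set X, IsOpen U ∧ (x : X) ∈ U ∧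
    ∃ F ∈ C, ∀ y : S, (y : X) ∈ U → f y = F y}

/-- The structure on the orbit space of a `G`-space with structure `C`: continuous functions
whose pull-back along the orbit map belongs to `C`. -/
def orbitSpace (G : Type*) {X : Type*} [Group G] [MulAction G X] [TopologicalSpace X]
    (C : Set (X → ℝ)) : Set (MulAction.orbitRel.Quotient G X → ℝ) :=
  {f | Continuous f ∧ (fun x : X => f (Quotient.mk _ x)) ∈ C}

end DifferentialSpace

namespace OrbitType

section

variable (G : Type*) {M : Type*} [Group G] [MulAction G M]

/-- The orbit map `M → M/G`. -/
def orbitMap (x : M) : MulAction.orbitRel.Quotient G M := Quotient.mk _ x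

variable {G}

/-- The orbit type set `M_(H)` of points whose isotropy group is conjugate to `H`. -/
def orbitTypeSet (M : Type*) [MulAction G M] (H : Subgroup G) : Set M :=
  {m | ∃ g : G, MulAction.stabilizer G m = H.map (MulAut.conj g).toMonoidHom}

theorem smul_mem_orbitTypeSet {H : Subgroup G} {m : M} (hm : m ∈ orbitTypeSet M H) (g : G) :
    g • m ∈ orbitTypeSet M H := by
  obtain ⟨k, hk⟩ := hm
  refine ⟨g * k, ?_⟩
  rw [MulAction.stabilizer_smul_eq_stabilizer_map_conj, hk, Subgroup.map_map, map_mul]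
  rfl

variable [TopologicalSpace G] [ConnectedSpace G] [TopologicalSpace M] [ContinuousSMul G M]

theorem smul_mem_component (H : Subgroup G) (m₀ : M) (g : G) {p : M}
    (hp : p ∈ connectedComponentIn (orbitTypeSet M H) m₀) :
    g • p ∈ connectedComponentIn (orbitTypeSet M H) m₀ := by
  have hpS : p ∈ orbitTypeSet M H := connectedComponentIn_subset _ _ hp
  rw [connectedComponentIn_eq hp]
  have hc : IsPreconnected (Set.range fun k : G => k • p) :=
    isPreconnected_range (continuous_id.smul continuous_const)
  refine hc.subset_connectedComponentIn ⟨1, one_smul G p⟩ ?_ ⟨g, rfl⟩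
  rintro _ ⟨k, rfl⟩
  exact smul_mem_orbitTypeSet hpS k

/-- The connected component `P` through `m₀` of the orbit type set `M_(H)`, with the action of the
connected group `G` restricted to it. -/
def component (H : Subgroup G) (m₀ : M) : SubMulAction G M where
  carrier := connectedComponentIn (orbitTypeSet M H) m₀
  smul_mem' g _ hp := smul_mem_component H m₀ g hp

/-- The image `π(P)` of the component `P` in the orbit space `M/G`. -/
def stratum (H : Subgroup G) (m₀ : M) : Set (MulAction.orbitRel.Quotient G M) :=
  orbitMap G '' (component H m₀ : Set M)

end

end OrbitType

open DifferentialSpace OrbitType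

/-!
Let `b` be a smooth bump function at a point of `M`. Properness makes the integrals of `b` and of
`b * u` over orbits, against a Haar measure of `G`, smooth invariant functions, and where the first
one is positive their quotient is an invariant average of `u`, equal to `u` wherever `u` is constant
along orbits. Hence invariant smooth functions separate orbits from closed invariant sets, so that
`C^∞(M/G)` induces the quotient topology, and an invariant function on `P` that locally extends to a
smooth function on `M` locally extends to an invariant one. The latter is the smoothness of `Λ⁻¹`.

An embedding has smooth local left inverses and a submersion has smooth local sections, so the
manifold structures on `P` and `P/G` have the same smooth functions as the induced ones. Finally,
the orbit map is an open quotient map whose fibres are connected when `G` is, and such a map sends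
connected components of saturated sets onto connected components of their images.
-/

section ParametricIntegral

open MeasureTheory Set Filter Topology

theorem integrable_of_continuousOn_univ_prod {N Y F : Type*} [TopologicalSpace N] [R1Space N]
    [MeasurableSpace N] [OpensMeasurableSpace N] {μ : Measure N} [IsFiniteMeasureOnCompacts μ]
    [TopologicalSpace Y] [NormedAddCommGroup F] {K : Set N} {U : Set Y} {f : N → Y → F}
    (hK : IsCompact K) (hf : ContinuousOn (fun p : N × Y => f p.1 p.2) (univ ×ˢ U))
    (h0 : ∀ x ∉ K, ∀ y ∈ U, f x y = 0) {y : Y} (hy : y ∈ U) :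
    Integrable (fun x => f x y) μ := by
  have h_continuous : Continuous fun x => f x y :=
    hf.comp_continuous (f := fun x => (x, y)) (by fun_prop) fun x => ⟨mem_univ x, hy⟩
  exact h_continuous.integrable_of_hasCompactSupport (.intro hK fun x hx => h0 x hx y hy)

variable {N E F : Type*} [TopologicalSpace N] [NormedAddCommGroup E] [NormedSpace ℝ E]
  [NormedAddCommGroup F] [NormedSpace ℝ F] {U : Set E} {K : Set N} {f : N → E → F}

theorem fderiv_eq_zero_of_isOpen {h : E → F} (hU : IsOpen U) (h0 : ∀ e ∈ U, h e = 0) {e : E}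
    (he : e ∈ U) : fderiv ℝ h e = 0 := by
  have h_eventually : h =ᶠ[𝓝 e] 0 := eventually_of_mem (hU.mem_nhds he) h0
  rw [h_eventually.fderiv_eq, fderiv_zero, Pi.zero_apply]

theorem hasFDerivAt_integral_of_continuousOn [T2Space N] [MeasurableSpace N]
    [OpensMeasurableSpace N] {μ : Measure N} [IsFiniteMeasureOnCompacts μ] [LocallyCompactSpace E]
    (hU : IsOpen U) (hK : IsCompact K)
    (hf : ContinuousOn (fun p : N × E => f p.1 p.2) (univ ×ˢ U))
    (hdiff : ∀ x, ∀ e ∈ U, DifferentiableAt ℝ (f x) e)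
    (hf' : ContinuousOn (fun p : N × E => fderiv ℝ (f p.1) p.2) (univ ×ˢ U))
    (h0 : ∀ x ∉ K, ∀ e ∈ U, f x e = 0) {e : E} (he : e ∈ U) :
    HasFDerivAt (fun e => ∫ x, f x e ∂μ) (∫ x, fderiv ℝ (f x) e ∂μ) e := by
  have h0' : ∀ x ∉ K, ∀ e ∈ U, fderiv ℝ (f x) e = 0 := fun x hx e he =>
    fderiv_eq_zero_of_isOpen hU (h0 x hx) he
  obtain ⟨s, hs, hsU, hs_compact⟩ := local_compact_nhds (hU.mem_nhds he)
  obtain ⟨C, hC⟩ := (hK.prod hs_compact).exists_bound_of_continuousOn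
    (hf'.mono (prod_mono (subset_univ _) hsU))
  refine hasFDerivAt_integral_of_dominated_of_fderiv_le (bound := K.indicator fun _ => C) hs
    ?_ (integrable_of_continuousOn_univ_prod hK hf h0 he)
    (integrable_of_continuousOn_univ_prod hK hf' h0' he).aestronglyMeasurable
    (.of_forall fun x e' he' => ?_)
    ((integrable_indicator_iff hK.measurableSet).2 (integrableOn_const hK.measure_lt_top.ne))
    (.of_forall fun x e' he' => (hdiff x e' (hsU he')).hasFDerivAt)
  · filter_upwards [hU.mem_nhds he] with e' he'
    exact (integrable_of_continuousOn_univ_prod hK hf h0 he').aestronglyMeasurable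
  · by_cases hx : x ∈ K
    · simpa [hx] using hC (x, e') ⟨hx, he'⟩
    · simp [hx, h0' x hx e' (hsU he')]

variable {EN : Type*} [NormedAddCommGroup EN] [NormedSpace ℝ EN] [ChartedSpace EN N]

theorem differentiableAt_of_contMDiffOn_univ_prod (hU : IsOpen U)
    (hf : ContMDiffOn (𝓘(ℝ, EN).prod 𝓘(ℝ, E)) 𝓘(ℝ, F) ∞ (fun p : N × E => f p.1 p.2)
      (univ ×ˢ U)) (x : N) {e : E} (he : e ∈ U) : DifferentiableAt ℝ (f x) e := by
  have h_slice : ContMDiffOn 𝓘(ℝ, E) 𝓘(ℝ, F) ∞ (f x) U :=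
    hf.comp (contMDiff_const.prodMk contMDiff_id).contMDiffOn fun _ he' => ⟨mem_univ x, he'⟩
  exact (h_slice.contDiffOn.contDiffAt (hU.mem_nhds he)).differentiableAt (by simp)

variable [IsManifold 𝓘(ℝ, EN) ∞ N]

theorem contMDiffOn_fderiv_snd (hU : IsOpen U)
    (hf : ContMDiffOn (𝓘(ℝ, EN).prod 𝓘(ℝ, E)) 𝓘(ℝ, F) ∞ (fun p : N × E => f p.1 p.2)
      (univ ×ˢ U)) :
    ContMDiffOn (𝓘(ℝ, EN).prod 𝓘(ℝ, E)) 𝓘(ℝ, E →L[ℝ] F) ∞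
      (fun p : N × E => fderiv ℝ (f p.1) p.2) (univ ×ˢ U) := by
  rintro ⟨x, e⟩ hxe
  have hfxe : ContMDiffAt (𝓘(ℝ, EN).prod 𝓘(ℝ, E)) 𝓘(ℝ, F) ∞
      (fun p : N × E => f p.1 p.2) (x, e) :=
    hf.contMDiffAt ((isOpen_univ.prod hU).mem_nhds hxe)
  have h_uncurry : ContMDiffAt ((𝓘(ℝ, EN).prod 𝓘(ℝ, E)).prod 𝓘(ℝ, E)) 𝓘(ℝ, F) ∞
      (Function.uncurry fun (p : N × E) (e' : E) => f p.1 e') ((x, e), e) :=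
    ContMDiffAt.comp (g := fun p : N × E => f p.1 p.2)
      (f := fun q : (N × E) × E => (q.1.1, q.2)) ((x, e), e) hfxe
      ((contMDiffAt_fst.comp _ contMDiffAt_fst).prodMk contMDiffAt_snd)
  have h_mfderiv := ContMDiffAt.mfderiv (m := ∞) (fun (p : N × E) (e' : E) => f p.1 e')
    (fun p : N × E => p.2) h_uncurry contMDiffAt_snd le_rfl
  simp only [mfderiv_eq_fderiv] at h_mfderiv
  rw [← inTangentCoordinates_model_space (I := 𝓘(ℝ, E)) (I' := 𝓘(ℝ, F))
    (fun p : N × E => p.2) (fun p => f p.1 p.2) (fun p => fderiv ℝ (f p.1) p.2) (x, e)]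
  exact h_mfderiv.contMDiffWithinAt

theorem contDiffOn_integral_of_contMDiffOn [T2Space N] [MeasurableSpace N]
    [OpensMeasurableSpace N] (μ : Measure N) [IsFiniteMeasureOnCompacts μ] [FiniteDimensional ℝ E]
    (hU : IsOpen U) (hK : IsCompact K)
    (hf : ContMDiffOn (𝓘(ℝ, EN).prod 𝓘(ℝ, E)) 𝓘(ℝ, F) ∞ (fun p : N × E => f p.1 p.2)
      (univ ×ˢ U)) (h0 : ∀ x ∉ K, ∀ e ∈ U, f x e = 0) :
    ContDiffOn ℝ ∞ (fun e => ∫ x, f x e ∂μ) U := by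
  have : ProperSpace E := FiniteDimensional.proper ℝ E
  rw [contDiffOn_infty]
  intro n
  induction n generalizing f with
  | zero =>
    rw [Nat.cast_zero, contDiffOn_zero]
    exact fun e he => (hasFDerivAt_integral_of_continuousOn hU hK hf.continuousOn
      (fun x _ => differentiableAt_of_contMDiffOn_univ_prod hU hf x)
      (contMDiffOn_fderiv_snd hU hf).continuousOn h0 he).continuousAt.continuousWithinAt
  | succ n ih =>
    have hf' := contMDiffOn_fderiv_snd hU hf
    have h0' : ∀ x ∉ K, ∀ e ∈ U, fderiv ℝ (f x) e = 0 := fun x hx e he =>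
      fderiv_eq_zero_of_isOpen hU (h0 x hx) he
    have h_deriv : ∀ e ∈ U,
        HasFDerivAt (fun e => ∫ x, f x e ∂μ) (∫ x, fderiv ℝ (f x) e ∂μ) e := fun e he =>
      hasFDerivAt_integral_of_continuousOn hU hK hf.continuousOn
        (fun x _ => differentiableAt_of_contMDiffOn_univ_prod hU hf x) hf'.continuousOn h0 he
    rw [Nat.cast_succ]
    refine contDiffOn_succ_of_fderiv_apply
      (fun e he => (h_deriv e he).differentiableAt.differentiableWithinAt) (by simp) fun v => ?_
    refine (ih (f := fun x e => fderiv ℝ (f x) e v) (hf'.clm_apply contMDiffOn_const)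
      fun x hx e he => by simp [h0' x hx e he]).congr fun e he => ?_
    rw [fderivWithin_of_isOpen hU he, (h_deriv e he).fderiv, ContinuousLinearMap.integral_apply
      (integrable_of_continuousOn_univ_prod hK hf'.continuousOn h0' he)]

end ParametricIntegral

section OrbitIntegral

open MeasureTheory Set

open scoped Pointwise

theorem apply_inv_smul_eq_zero {G X F : Type*} [Group G] [MulAction G X] [TopologicalSpace X]
    [Zero F] {u : X → F} {A : Set X} {g : G}
    (hg : g ∉ {g : G | (g • tsupport u ∩ A).Nonempty}) {x : X} (hx : x ∈ A) :
    u (g⁻¹ • x) = 0 := by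
  by_contra hu
  exact hg ⟨x, Set.mem_smul_set_iff_inv_smul_mem.2 (subset_tsupport u hu), hx⟩

variable {G M F : Type*} [Group G] [MulAction G M] [MeasurableSpace G]
  [NormedAddCommGroup F] [NormedSpace ℝ F]

/-- The integral of `u` along the orbit of `m`, weighted by the measure `μ` on the group. The
inverse makes it an invariant function of `m` when `μ` is left invariant. -/
noncomputable def orbitIntegral (μ : Measure G) (u : M → F) (m : M) : F :=
  ∫ g, u (g⁻¹ • m) ∂μ

theorem orbitIntegral_apply_smul [MeasurableMul G] (μ : Measure G) [μ.IsMulLeftInvariant]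
    (u : M → F) (h : G) (m : M) : orbitIntegral μ u (h • m) = orbitIntegral μ u m := by
  unfold orbitIntegral
  rw [← integral_mul_left_eq_self (fun g => u (g⁻¹ • h • m)) h]
  simp [mul_smul]

theorem exists_ne_zero_of_orbitIntegral_ne_zero {μ : Measure G} {u : M → F} {m : M}
    (h : orbitIntegral μ u m ≠ 0) : ∃ g : G, u (g • m) ≠ 0 := by
  by_contra! hu
  exact h (by simp [orbitIntegral, hu])

theorem orbitIntegral_mul_eq {μ : Measure G} {u v : M → ℝ} {m : M} {c : ℝ}
    (h : ∀ g : G, u (g • m) ≠ 0 → v (g • m) = c) :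
    orbitIntegral μ (u * v) m = orbitIntegral μ u m * c := by
  have h_mul : ∀ g : G, (u * v) (g • m) = u (g • m) * c := fun g => by
    by_cases hu : u (g • m) = 0
    · simp [hu]
    · rw [Pi.mul_apply, h g hu]
  simp only [orbitIntegral, h_mul, integral_mul_const]

variable [TopologicalSpace G] [BorelSpace G] [TopologicalSpace M] [ProperSMul G M]

theorem orbitIntegral_pos [IsTopologicalGroup G] (μ : Measure G) [IsFiniteMeasureOnCompacts μ]
    [μ.IsOpenPosMeasure] {u : M → ℝ} (hu : Continuous u) (hc : HasCompactSupport u)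
    (h0 : ∀ m, 0 ≤ u m) {m : M} (hm : u m ≠ 0) : 0 < orbitIntegral μ u m := by
  have h_compact : HasCompactSupport fun g : G => u (g⁻¹ • m) :=
    .intro (ProperSMul.isCompact_setOfPred_inter_nonempty hc isCompact_singleton)
      fun _ hg => apply_inv_smul_eq_zero hg rfl
  have h_cont : Continuous fun g : G => u (g⁻¹ • m) :=
    hu.comp (continuous_inv.smul continuous_const)
  exact h_cont.integral_pos_of_hasCompactSupport_nonneg_nonzero h_compact (fun _ => h0 _)
    (x := 1) (by simpa using hm)

theorem contMDiff_orbitIntegral [T2Space G]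
    {EG : Type*} [NormedAddCommGroup EG] [NormedSpace ℝ EG] [ChartedSpace EG G]
    [LieGroup 𝓘(ℝ, EG) ∞ G]
    {EM : Type*} [NormedAddCommGroup EM] [NormedSpace ℝ EM] [FiniteDimensional ℝ EM]
    [ChartedSpace EM M] [IsManifold 𝓘(ℝ, EM) ∞ M] [ContMDiffSMul 𝓘(ℝ, EG) 𝓘(ℝ, EM) ∞ G M]
    (μ : Measure G) [IsFiniteMeasureOnCompacts μ] {u : M → F}
    (hu : ContMDiff 𝓘(ℝ, EM) 𝓘(ℝ, F) ∞ u) (hc : HasCompactSupport u) :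
    ContMDiff 𝓘(ℝ, EM) 𝓘(ℝ, F) ∞ (orbitIntegral μ u) := by
  intro m
  have : LocallyCompactSpace M := Manifold.locallyCompact_of_finiteDimensional 𝓘(ℝ, EM)
  obtain ⟨A, hA, hAm⟩ := exists_compact_mem_nhds m
  set φ := extChartAt 𝓘(ℝ, EM) m
  set U : Set EM := interior (φ.symm ⁻¹' A) ∩ φ.target
  have hU : IsOpen U := isOpen_interior.inter (isOpen_extChartAt_target m)
  have hmU : φ m ∈ U := ⟨mem_interior_iff_mem_nhds.2 (extChartAt_preimage_mem_nhds hAm),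
    mem_extChartAt_target m⟩
  have h_action : ContMDiffOn (𝓘(ℝ, EG).prod 𝓘(ℝ, EM)) 𝓘(ℝ, EM) ∞
      (fun p : G × EM => p.1⁻¹ • φ.symm p.2) (univ ×ˢ U) :=
    (contMDiff_smul (I := 𝓘(ℝ, EG)) (I' := 𝓘(ℝ, EM)) (n := ∞) (G := G) (M := M)).comp_contMDiffOn
      (contMDiff_fst.inv.contMDiffOn.prodMk
        ((contMDiffOn_extChartAt_symm m).comp contMDiffOn_snd fun _ hp => hp.2.2))
  have h_chart : ContDiffOn ℝ ∞ (fun e => orbitIntegral μ u (φ.symm e)) U :=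
    contDiffOn_integral_of_contMDiffOn μ hU
      (ProperSMul.isCompact_setOfPred_inter_nonempty (G := G) hc hA)
      (f := fun g e => u (g⁻¹ • φ.symm e)) (hu.comp_contMDiffOn h_action) fun g hg e he =>
        apply_inv_smul_eq_zero hg (interior_subset (s := φ.symm ⁻¹' A) he.1)
  refine ((h_chart.contDiffAt (hU.mem_nhds hmU)).contMDiffAt.comp m
    contMDiffAt_extChartAt).congr_of_eventuallyEq ?_
  filter_upwards [extChartAt_source_mem_nhds (I := 𝓘(ℝ, EM)) m] with x hx
  rw [Function.comp_apply, φ.left_inv hx]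

end OrbitIntegral

namespace DifferentialSpace

open Set Filter Topology

section Basic

variable {X : Type*} [t : TopologicalSpace X] {C : Set (X → ℝ)}

theorem eq_generateFrom_of_separating (hC : ∀ f ∈ C, Continuous f)
    (hsep : ∀ (x : X) (U : Set X), IsOpen U → x ∈ U → ∃ f ∈ C, 0 < f x ∧ ∀ y, 0 < f y → y ∈ U) :
    t = TopologicalSpace.generateFrom {s : Set X | ∃ f ∈ C, ∃ a b : ℝ, s = f ⁻¹' Ioo a b} := by
  refine le_antisymm (le_generateFrom ?_) fun U hU => ?_
  · rintro _ ⟨f, hf, a, b, rfl⟩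
    exact isOpen_Ioo.preimage (hC f hf)
  · refine (@isOpen_iff_forall_mem_open X (TopologicalSpace.generateFrom _) U).2 fun x hx => ?_
    obtain ⟨f, hf, hfx, hfU⟩ := hsep x U hU hx
    exact ⟨f ⁻¹' Ioo 0 (f x + 1), fun y hy => hfU y hy.1,
      TopologicalSpace.isOpen_generateFrom_of_mem ⟨f, hf, _, _, rfl⟩, hfx, by simp⟩

theorem comp_val_mem_restrict {f : X → ℝ} (hf : f ∈ C) (S : Set X) :
    (fun y : S => f y) ∈ restrict C S := fun _ =>
  ⟨univ, isOpen_univ, mem_univ _, f, hf, fun _ _ => rfl⟩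

theorem continuous_of_mem_restrict (hC : ∀ f ∈ C, Continuous f) {S : Set X} {f : S → ℝ}
    (hf : f ∈ restrict C S) : Continuous f := by
  refine continuous_iff_continuousAt.2 fun x => ?_
  obtain ⟨U, hU, hxU, F, hF, h⟩ := hf x
  refine ((hC F hF).comp continuous_subtype_val).continuousAt.congr ?_
  filter_upwards [(hU.preimage continuous_subtype_val).mem_nhds hxU] with y hy
  exact (h y hy).symm

theorem IsDifferentialStructure.continuous (hC : IsDifferentialStructure C) {f : X → ℝ}
    (hf : f ∈ C) : Continuous f := by
  have h_isOpen : ∀ a b, IsOpen (f ⁻¹' Ioo a b) := fun a b => by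
    rw [hC.subbasis]
    exact TopologicalSpace.isOpen_generateFrom_of_mem ⟨f, hf, a, b, rfl⟩
  exact continuous_iff_continuousAt.2 fun x =>
    (nhds_basis_Ioo (f x)).tendsto_right_iff.2 fun ⟨a, b⟩ hab => (h_isOpen a b).mem_nhds hab

theorem IsDifferentialStructure.restrict (hC : IsDifferentialStructure C) (S : Set X) :
    IsDifferentialStructure (restrict C S) where
  subbasis := by
    refine le_antisymm (le_generateFrom ?_) ?_
    · rintro _ ⟨f, hf, a, b, rfl⟩
      exact isOpen_Ioo.preimage (continuous_of_mem_restrict (fun _ => hC.continuous) hf)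
    · have h_induced : (instTopologicalSpaceSubtype : TopologicalSpace S) =
          .generateFrom (preimage (↑) '' {s : Set X | ∃ f ∈ C, ∃ a b : ℝ, s = f ⁻¹' Ioo a b}) := by
        rw [← induced_generateFrom_eq, ← hC.subbasis, instTopologicalSpaceSubtype]
      rw [h_induced]
      refine le_generateFrom ?_
      rintro _ ⟨_, ⟨f, hf, a, b, rfl⟩, rfl⟩
      exact TopologicalSpace.isOpen_generateFrom_of_mem
        ⟨fun y => f y, comp_val_mem_restrict hf S, a, b, rfl⟩
  comp_mem n f hf F hF x := by
    choose U hU hxU g hg h using fun i => hf i x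
    exact ⟨⋂ i, U i, isOpen_iInter_of_finite hU, mem_iInter.2 hxU, _, hC.comp_mem n g hg F hF,
      fun y hy => congrArg F (funext fun i => h i y (mem_iInter.1 hy i))⟩
  local_mem f hf x := by
    obtain ⟨U, hU, hxU, g, hg, h⟩ := hf x
    obtain ⟨V, hV, rfl⟩ := isOpen_induced_iff.1 hU
    obtain ⟨W, hW, hxW, F, hF, h'⟩ := hg x
    exact ⟨V ∩ W, hV.inter hW, ⟨hxU, hxW⟩, F, hF,
      fun y hy => (h hy.1).symm.trans (h' y hy.2)⟩

end Basic

section OrbitSpace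

variable {G X : Type*} [Group G] [MulAction G X]

theorem orbitMap_smul (g : G) (x : X) : orbitMap G (g • x) = orbitMap G x :=
  Quotient.sound ⟨g, rfl⟩

/-- The bijection `Λ : P/G ≃ π(P)` induced by the inclusion of an invariant subset `P`. -/
noncomputable def orbitQuotientEquivImage (P : SubMulAction G X) :
    MulAction.orbitRel.Quotient G P ≃ orbitMap G '' (P : Set X) :=
  Equiv.ofBijective
    (Quotient.lift (fun p : P => ⟨orbitMap G (p : X), p, p.2, rfl⟩) (by
      rintro _ q ⟨g, rfl⟩
      exact Subtype.ext (orbitMap_smul g (q : X))))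
    ⟨by
      rintro ⟨p⟩ ⟨q⟩ h
      obtain ⟨g, hg⟩ : (p : X) ∈ MulAction.orbit G (q : X) :=
        Quotient.exact (congrArg Subtype.val h)
      exact Quotient.sound ⟨g, Subtype.ext hg⟩, by
      rintro ⟨_, p, hp, rfl⟩
      exact ⟨orbitMap G ⟨p, hp⟩, rfl⟩⟩

theorem orbitQuotientEquivImage_symm_apply (P : SubMulAction G X) (p : P) :
    (orbitQuotientEquivImage P).symm ⟨orbitMap G (p : X), p, p.2, rfl⟩ = orbitMap G p :=
  (Equiv.symm_apply_eq _).2 rfl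

variable [TopologicalSpace X] {C : Set (X → ℝ)}

theorem exists_mem_orbitSpace_of_invariant {F : X → ℝ} (hF : F ∈ C) (hF_cont : Continuous F)
    (hF_inv : ∀ (g : G) x, F (g • x) = F x) :
    ∃ f ∈ orbitSpace G C, ∀ x, f (orbitMap G x) = F x :=
  ⟨Quotient.lift F (by rintro _ x ⟨g, rfl⟩; exact hF_inv g x),
    ⟨hF_cont.quotient_lift _, hF⟩, fun _ => rfl⟩

theorem isSmoothMap_orbitQuotientEquivImage (hC : ∀ f ∈ C, Continuous f) (P : SubMulAction G X) :
    IsSmoothMap (orbitSpace G (X := P) (restrict C P))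
      (restrict (orbitSpace G C) (orbitMap G '' (P : Set X))) (orbitQuotientEquivImage P) := by
  intro f hf
  have hfP : (fun p : P => f (orbitQuotientEquivImage P (orbitMap G p))) ∈ restrict C P := by
    intro p
    obtain ⟨U, hU, hpU, F, hF, h⟩ := hf (orbitQuotientEquivImage P (orbitMap G p))
    exact ⟨orbitMap G ⁻¹' U, hU.preimage continuous_quotient_mk', hpU, _, hF.2,
      fun q hq => h _ hq⟩
  exact ⟨continuous_coinduced_dom.2 (continuous_of_mem_restrict hC hfP), hfP⟩

variable (G C) in
/-- Averaging over orbits is possible in the structure `C`: near the orbit of any point `x`,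
detected by the positivity of an invariant function `D`, each `u ∈ C` has an invariant average `A`
that depends only on the values of `u` in a prescribed neighbourhood `V` of `x`. All that is
recorded of `A` is that it agrees with `u` on every orbit along which `u` is constant in `V`. -/
def HasInvariantAverages : Prop :=
  ∀ u ∈ C, ∀ x, ∀ V ∈ 𝓝 x, ∃ D ∈ orbitSpace G C, ∃ A ∈ orbitSpace G C, 0 < D (orbitMap G x) ∧
    ∀ y, 0 < D (orbitMap G y) → (∃ g : G, g • y ∈ V) ∧
      ∀ c, (∀ g : G, g • y ∈ V → u (g • y) = c) → A (orbitMap G y) = c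

theorem IsDifferentialStructure.orbitSpace (hC : IsDifferentialStructure C)
    (hG : HasInvariantAverages G C) : IsDifferentialStructure (orbitSpace G C) where
  subbasis := by
    refine eq_generateFrom_of_separating (fun f hf => hf.1) ?_
    rintro ⟨x⟩ U hU hxU
    have h_const : (fun _ : X => (0 : ℝ)) ∈ C :=
      hC.comp_mem 0 Fin.elim0 (fun i => i.elim0) (fun _ => 0) contDiff_const
    obtain ⟨D, hD, _, _, hDx, hDV⟩ := hG _ h_const x (orbitMap G ⁻¹' U)
      ((hU.preimage continuous_quotient_mk').mem_nhds hxU)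
    refine ⟨D, hD, hDx, ?_⟩
    rintro ⟨y⟩ hy
    obtain ⟨g, hg⟩ := (hDV y hy).1
    rwa [mem_preimage, orbitMap_smul] at hg
  comp_mem n f hf F hF :=
    ⟨hF.continuous.comp (continuous_pi fun i => (hf i).1),
      hC.comp_mem n (fun i x => f i (orbitMap G x)) (fun i => (hf i).2) F hF⟩
  local_mem f hf := by
    refine ⟨continuous_iff_continuousAt.2 fun x => ?_, hC.local_mem _ fun x => ?_⟩
    · obtain ⟨U, hU, hxU, g, hg, h⟩ := hf x
      exact hg.1.continuousAt.congr (h.eventuallyEq_of_mem (hU.mem_nhds hxU))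
    · obtain ⟨U, hU, hxU, g, hg, h⟩ := hf (orbitMap G x)
      exact ⟨_, hU.preimage continuous_quotient_mk', hxU, _, hg.2, fun y hy => h hy⟩

namespace HasInvariantAverages

theorem restrict (hG : HasInvariantAverages G C) (hC : ∀ f ∈ C, Continuous f)
    (P : SubMulAction G X) : HasInvariantAverages G (X := P) (restrict C P) := by
  intro u hu x V hV
  obtain ⟨U, hU, hxU, F, hF, huF⟩ := hu x
  obtain ⟨W, hW, hWV⟩ := mem_nhds_subtype _ _ _ |>.1 hV
  obtain ⟨D, hD, A, hA, hDx, hDA⟩ := hG F hF x (W ∩ U) (inter_mem hW (hU.mem_nhds hxU))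
  have h_pullback : ∀ f ∈ orbitSpace G C, (fun q => f (orbitQuotientEquivImage P q)) ∈
      orbitSpace G (X := P) (DifferentialSpace.restrict C P) := fun f hf =>
    isSmoothMap_orbitQuotientEquivImage hC P _ (comp_val_mem_restrict hf _)
  refine ⟨_, h_pullback D hD, _, h_pullback A hA, hDx, fun y hy => ⟨?_, fun c hc => ?_⟩⟩
  · obtain ⟨g, hg⟩ := (hDA y hy).1
    exact ⟨g, hWV hg.1⟩
  · exact (hDA y hy).2 c fun g hg => (huF (g • y) hg.2).symm.trans (hc g (hWV hg.1))

theorem isSmoothMap_orbitQuotientEquivImage_symm (hG : HasInvariantAverages G C)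
    (P : SubMulAction G X) :
    IsSmoothMap (DifferentialSpace.restrict (orbitSpace G C) (orbitMap G '' (P : Set X)))
      (orbitSpace G (X := P) (DifferentialSpace.restrict C P))
      (orbitQuotientEquivImage P).symm := by
  rintro f ⟨-, hf⟩ ⟨_, p, hp, rfl⟩
  obtain ⟨V, hV, hpV, u, hu, hfu⟩ := hf ⟨p, hp⟩
  obtain ⟨D, hD, A, hA, hDp, hDA⟩ := hG u hu p V (hV.mem_nhds hpV)
  refine ⟨D ⁻¹' Ioi 0, isOpen_Ioi.preimage hD.1, hDp, A, hA, ?_⟩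
  rintro ⟨_, q, hq, rfl⟩ hDq
  rw [Function.comp_apply, orbitQuotientEquivImage_symm_apply P ⟨q, hq⟩]
  refine ((hDA q hDq).2 _ fun g hg => ?_).symm
  rw [← orbitMap_smul g]
  exact (hfu (g • ⟨q, hq⟩) hg).symm

theorem isDiffeomorphism_orbitQuotientEquivImage (hG : HasInvariantAverages G C)
    (hC : ∀ f ∈ C, Continuous f) (P : SubMulAction G X) :
    IsDiffeomorphism (orbitSpace G (X := P) (DifferentialSpace.restrict C P))
      (DifferentialSpace.restrict (orbitSpace G C) (orbitMap G '' (P : Set X)))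
      (orbitQuotientEquivImage P) :=
  ⟨isSmoothMap_orbitQuotientEquivImage hC P, hG.isSmoothMap_orbitQuotientEquivImage_symm P⟩

end HasInvariantAverages

end OrbitSpace

theorem isDifferentialStructure_ofManifold {E : Type*} [NormedAddCommGroup E] [NormedSpace ℝ E]
    [FiniteDimensional ℝ E] (M : Type*) [TopologicalSpace M] [ChartedSpace E M] [T2Space M]
    [IsManifold 𝓘(ℝ, E) ∞ M] : IsDifferentialStructure (ofManifold (E := E) M) where
  subbasis := by
    refine eq_generateFrom_of_separating (fun f hf => ContMDiff.continuous hf)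
      fun x U hU hxU => ?_
    obtain ⟨b, -, hb⟩ := (SmoothBumpFunction.nhds_basis_tsupport (I := 𝓘(ℝ, E)) x).mem_iff.1
      (hU.mem_nhds hxU)
    exact ⟨b, b.contMDiff, by simp, fun y hy => hb (subset_tsupport _ hy.ne')⟩
  comp_mem n f hf F hF := hF.contMDiff.comp (contMDiff_pi_space.2 hf)
  local_mem f hf x := by
    obtain ⟨U, hU, hxU, g, hg, h⟩ := hf x
    exact (hg x).congr_of_eventuallyEq (h.eventuallyEq_of_mem (hU.mem_nhds hxU)).symm

end DifferentialSpace

section SmoothProperAction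

open MeasureTheory Set Topology

theorem exists_contDiff_eqOn_inv {d : ℝ} (hd : 0 < d) :
    ∃ θ : ℝ → ℝ, ContDiff ℝ ∞ θ ∧ EqOn θ (·⁻¹) (Ici d) := by
  let s : ℝ → ℝ := fun t => Real.smoothTransition (t / d)
  have hs : ContDiff ℝ ∞ s := Real.smoothTransition.contDiff.comp (contDiff_id.div_const d)
  -- The denominator interpolates between `1` for `t ≤ 0` and `t` for `d ≤ t`.
  have h_pos : ∀ t, 0 < s t * t + (1 - s t) := fun t => by
    have h_le_one : s t ≤ 1 := Real.smoothTransition.le_one _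
    rcases le_or_gt t 0 with ht | ht
    · simp [s, Real.smoothTransition.zero_of_nonpos (div_nonpos_of_nonpos_of_nonneg ht hd.le)]
    · have h_s_pos : 0 < s t := Real.smoothTransition.pos_of_pos (div_pos ht hd)
      have := mul_pos h_s_pos ht
      linarith
  refine ⟨fun t => (s t * t + (1 - s t))⁻¹,
    ((hs.mul contDiff_id).add (contDiff_const.sub hs)).inv fun t => (h_pos t).ne', fun t ht => ?_⟩
  simp [s, Real.smoothTransition.one_of_one_le ((one_le_div₀ hd).2 ht)]

variable (G : Type*) [Group G] [TopologicalSpace G] [T2Space G]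
  {EM : Type*} [NormedAddCommGroup EM] [NormedSpace ℝ EM] [FiniteDimensional ℝ EM]
  {M : Type*} [TopologicalSpace M] [ChartedSpace EM M] [T2Space M] [IsManifold 𝓘(ℝ, EM) ∞ M]
  [MulAction G M] [ProperSMul G M]

theorem exists_invariant_weight_and_weighted_average
    (EG : Type*) [NormedAddCommGroup EG] [NormedSpace ℝ EG] [FiniteDimensional ℝ EG]
    [ChartedSpace EG G] [LieGroup 𝓘(ℝ, EG) ∞ G] [ContMDiffSMul 𝓘(ℝ, EG) 𝓘(ℝ, EM) ∞ G M]
    {u : M → ℝ}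
    (hu : ContMDiff 𝓘(ℝ, EM) 𝓘(ℝ, ℝ) ∞ u) {x : M} {V : Set M} (hV : V ∈ 𝓝 x) :
    ∃ B N : M → ℝ, ContMDiff 𝓘(ℝ, EM) 𝓘(ℝ, ℝ) ∞ B ∧ ContMDiff 𝓘(ℝ, EM) 𝓘(ℝ, ℝ) ∞ N ∧
      (∀ (g : G) y, B (g • y) = B y) ∧ (∀ (g : G) y, N (g • y) = N y) ∧ 0 < B x ∧
      (∀ y, B y ≠ 0 → ∃ g : G, g • y ∈ V) ∧
      ∀ y c, (∀ g : G, g • y ∈ V → u (g • y) = c) → N y = B y * c := by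
  have : IsTopologicalGroup G := topologicalGroup_of_lieGroup 𝓘(ℝ, EG) ∞
  have : LocallyCompactSpace G := Manifold.locallyCompact_of_finiteDimensional 𝓘(ℝ, EG)
  let : MeasurableSpace G := borel G
  have : BorelSpace G := ⟨rfl⟩
  let μ : Measure G := Measure.haar
  obtain ⟨b, -, hb⟩ := (SmoothBumpFunction.nhds_basis_tsupport (I := 𝓘(ℝ, EM)) x).mem_iff.1 hV
  have hbV : ∀ y, b y ≠ 0 → y ∈ V := fun y hy => hb (subset_tsupport b hy)
  exact ⟨orbitIntegral μ b, orbitIntegral μ (⇑b * u),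
    contMDiff_orbitIntegral (EG := EG) μ b.contMDiff b.hasCompactSupport,
    contMDiff_orbitIntegral (EG := EG) μ (b.contMDiff.mul hu) b.hasCompactSupport.mul_right,
    orbitIntegral_apply_smul μ _, orbitIntegral_apply_smul μ _,
    orbitIntegral_pos μ b.continuous b.hasCompactSupport (fun _ => b.nonneg) (by simp),
    fun y hy => (exists_ne_zero_of_orbitIntegral_ne_zero hy).imp fun g => hbV (g • y),
    fun y c hc => orbitIntegral_mul_eq fun g hg => hc g (hbV _ hg)⟩

variable (EM M) in
theorem hasInvariantAverages_ofManifold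
    (EG : Type*) [NormedAddCommGroup EG] [NormedSpace ℝ EG] [FiniteDimensional ℝ EG]
    [ChartedSpace EG G] [LieGroup 𝓘(ℝ, EG) ∞ G] [ContMDiffSMul 𝓘(ℝ, EG) 𝓘(ℝ, EM) ∞ G M] :
    HasInvariantAverages G (ofManifold (E := EM) M) := by
  intro u hu x V hV
  obtain ⟨B, N, hB, hN, hBG, hNG, hBx, hBV, hNB⟩ :=
    exists_invariant_weight_and_weighted_average G EG hu hV
  obtain ⟨θ, hθ_smooth, hθ⟩ := exists_contDiff_eqOn_inv (half_pos hBx)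
  have hD_smooth : ContMDiff 𝓘(ℝ, EM) 𝓘(ℝ, ℝ) ∞ fun y => B y - B x / 2 :=
    hB.sub contMDiff_const
  have hA_smooth : ContMDiff 𝓘(ℝ, EM) 𝓘(ℝ, ℝ) ∞ fun y => N y * θ (B y) :=
    hN.mul (hθ_smooth.contMDiff.comp hB)
  obtain ⟨D, hD_mem, hD⟩ := exists_mem_orbitSpace_of_invariant (G := G)
    (C := ofManifold (E := EM) M) hD_smooth hD_smooth.continuous fun g y => by rw [hBG]
  obtain ⟨A, hA_mem, hA⟩ := exists_mem_orbitSpace_of_invariant (G := G)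
    (C := ofManifold (E := EM) M) hA_smooth hA_smooth.continuous fun g y => by rw [hNG, hBG]
  refine ⟨D, hD_mem, A, hA_mem, by rw [hD]; linarith, fun y hy => ?_⟩
  have hBy : B x / 2 < B y := by rwa [hD, sub_pos] at hy
  have hBy0 : B y ≠ 0 := ((half_pos hBx).trans hBy).ne'
  refine ⟨hBV y hBy0, fun c hc => ?_⟩
  rw [hA, hNB y c hc, hθ hBy.le, mul_right_comm, mul_inv_cancel₀ hBy0, one_mul]

end SmoothProperAction

section ImmersionsAndSubmersions

open Set Filter Topology Manifold

section LocalInverses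

variable {𝕜 : Type*} [NontriviallyNormedField 𝕜]
  {E : Type*} [NormedAddCommGroup E] [NormedSpace 𝕜 E]
  {F : Type*} [NormedAddCommGroup F] [NormedSpace 𝕜 F]
  {H : Type*} [TopologicalSpace H] {I : ModelWithCorners 𝕜 E H} [I.Boundaryless]
  {K : Type*} [TopologicalSpace K] {J : ModelWithCorners 𝕜 F K}
  {M : Type*} [TopologicalSpace M] [ChartedSpace H M]
  {N : Type*} [TopologicalSpace N] [ChartedSpace K N]
  {n : ℕ∞ω} {f : M → N} {x : M}

theorem exists_contMDiffOn_leftInverse_of_isImmersionAt (hf : IsImmersionAt I J n f x) :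
    ∃ r : N → M, ∃ V : Set N, IsOpen V ∧ f x ∈ V ∧ ContMDiffOn J I n r V ∧
      ∀ᶠ y in 𝓝 x, r (f y) = y := by
  set φ := hf.domChart.extend I
  set ψ := hf.codChart.extend J
  let pr : F → E := fun v => (hf.equiv.symm v).1
  have hpr : ContDiff 𝕜 n pr := contDiff_fst.comp hf.equiv.symm.contDiff
  have hφ_source : φ.source = hf.domChart.source := hf.domChart.extend_source
  have hφ_symm : ContMDiffOn 𝓘(𝕜, E) I n φ.symm φ.target := by
    rw [hf.domChart.extend_target']
    exact contMDiffOn_extend_symm hf.domChart_mem_maximalAtlas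
  have hψ : ContMDiffOn J 𝓘(𝕜, F) n ψ hf.codChart.source := fun y hy =>
    (hf.codChart.contMDiffAt_extend hf.codChart_mem_maximalAtlas hy).contMDiffWithinAt
  have h_proj : ∀ y ∈ φ.source, pr (ψ (f y)) = φ y := fun y hy => by
    have h_written : ψ (f (φ.symm (φ y))) = hf.equiv (φ y, 0) :=
      hf.writtenInCharts (φ.map_source hy)
    rw [φ.left_inv hy] at h_written
    simp only [pr, h_written, hf.equiv.symm_apply_apply]
  have hx : x ∈ φ.source := hφ_source ▸ hf.mem_domChart_source
  refine ⟨fun z => φ.symm (pr (ψ z)), hf.codChart.source ∩ (fun z => pr (ψ z)) ⁻¹' φ.target,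
    (hpr.continuous.comp_continuousOn hψ.continuousOn).isOpen_inter_preimage
      hf.codChart.open_source hf.domChart.isOpen_extend_target,
    ⟨hf.mem_codChart_source, ?_⟩, ?_, ?_⟩
  · rw [mem_preimage, h_proj x hx]
    exact φ.map_source hx
  · exact hφ_symm.comp (hpr.contMDiff.comp_contMDiffOn (hψ.mono inter_subset_left))
      fun z hz => hz.2
  · filter_upwards [hf.domChart.extend_source_mem_nhds (I := I) hf.mem_domChart_source] with y hy
    rw [h_proj y hy, φ.left_inv hy]

theorem exists_contMDiffAt_rightInverse_of_isSubmersionAt (hf : IsSubmersionAt I J n f x) :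
    ∃ s : N → M, ContMDiffAt J I n s (f x) ∧ s (f x) = x ∧ ∀ᶠ z in 𝓝 (f x), f (s z) = z := by
  set φ := hf.domChart.extend I
  set ψ := hf.codChart.extend J
  have hφ_source : φ.source = hf.domChart.source := hf.domChart.extend_source
  have hψ_source : ψ.source = hf.codChart.source := hf.codChart.extend_source
  have hx : x ∈ φ.source := hφ_source ▸ hf.mem_domChart_source
  have hφ_target : φ.target ∈ 𝓝 (φ x) :=
    hf.domChart.isOpen_extend_target.mem_nhds (φ.map_source hx)
  have hφ_symm : ContMDiffOn 𝓘(𝕜, E) I n φ.symm φ.target := by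
    rw [hf.domChart.extend_target']
    exact contMDiffOn_extend_symm hf.domChart_mem_maximalAtlas
  have h_written : ∀ v ∈ φ.target, ψ (f (φ.symm v)) = (hf.equiv v).1 :=
    fun v hv => hf.writtenInCharts hv
  let s : N → E := fun z => hf.equiv.symm (ψ z, (hf.equiv (φ x)).2)
  have hs : ContMDiffAt J 𝓘(𝕜, E) n s (f x) :=
    hf.equiv.symm.contDiff.contMDiff.contMDiffAt.comp (f x)
      ((hf.codChart.contMDiffAt_extend hf.codChart_mem_maximalAtlas
        hf.mem_codChart_source).prodMk_space contMDiffAt_const)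
  have hsx : s (f x) = φ x := by
    have h_fst : ψ (f x) = (hf.equiv (φ x)).1 := by
      simpa only [φ.left_inv hx] using h_written (φ x) (φ.map_source hx)
    simp only [s, h_fst, Prod.mk.eta, hf.equiv.symm_apply_apply]
  refine ⟨fun z => φ.symm (s z), ?_, (congrArg φ.symm hsx).trans (φ.left_inv hx), ?_⟩
  · exact ContMDiffAt.comp (f x) (hφ_symm.contMDiffAt (hsx ▸ hφ_target)) hs
  · filter_upwards [hs.continuousAt.preimage_mem_nhds (hsx ▸ hφ_target),
      hf.codChart.extend_source_mem_nhds (I := J) hf.mem_codChart_source] with z hz_target hz_source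
    have h_source : f (φ.symm (s z)) ∈ ψ.source :=
      hψ_source ▸ hf.source_subset_preimage_source (hφ_source ▸ φ.map_target hz_target)
    refine ψ.injOn h_source hz_source ?_
    rw [h_written _ hz_target, hf.equiv.apply_symm_apply]

theorem contMDiffAt_of_comp_isSubmersionAt
    {E' : Type*} [NormedAddCommGroup E'] [NormedSpace 𝕜 E']
    {H' : Type*} [TopologicalSpace H'] {I' : ModelWithCorners 𝕜 E' H'}
    {M' : Type*} [TopologicalSpace M'] [ChartedSpace H' M'] {g : N → M'}
    (hf : IsSubmersionAt I J n f x) (hgf : ContMDiffAt I I' n (g ∘ f) x) :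
    ContMDiffAt J I' n g (f x) := by
  obtain ⟨s, hs, hsx, hfs⟩ := exists_contMDiffAt_rightInverse_of_isSubmersionAt hf
  have hgfs : ContMDiffAt J I' n ((g ∘ f) ∘ s) (f x) :=
    ContMDiffAt.comp (f x) (by rwa [hsx]) hs
  exact hgfs.congr_of_eventuallyEq (hfs.mono fun z hz => (congrArg g hz).symm)

end LocalInverses

theorem exists_contMDiff_eventuallyEq_of_contMDiffOn
    {E : Type*} [NormedAddCommGroup E] [NormedSpace ℝ E] [FiniteDimensional ℝ E]
    {H : Type*} [TopologicalSpace H] {I : ModelWithCorners ℝ E H}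
    {M : Type*} [TopologicalSpace M] [ChartedSpace H M] [T2Space M] [IsManifold I ∞ M]
    {F : Type*} [NormedAddCommGroup F] [NormedSpace ℝ F]
    {f : M → F} {V : Set M} (hf : ContMDiffOn I 𝓘(ℝ, F) ∞ f V) {x : M} (hV : V ∈ 𝓝 x) :
    ∃ g : M → F, ContMDiff I 𝓘(ℝ, F) ∞ g ∧ g =ᶠ[𝓝 x] f := by
  obtain ⟨b, -, hb⟩ := (SmoothBumpFunction.nhds_basis_tsupport (I := I) x).mem_iff.1
    (interior_mem_nhds.2 hV)
  refine ⟨fun y => b y • f y, contMDiff_of_tsupport fun y hy => ?_, ?_⟩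
  · have hyV : V ∈ 𝓝 y := mem_interior_iff_mem_nhds.1 (hb (tsupport_smul_subset_left b f hy))
    exact b.contMDiff.contMDiffAt.smul (hf.contMDiffAt hyV)
  · filter_upwards [b.eventuallyEq_one] with y hy
    rw [hy, Pi.one_apply, one_smul]

end ImmersionsAndSubmersions

namespace DifferentialSpace

open Filter Topology

theorem ofManifold_eq_restrict_of_isSmoothEmbedding
    {E : Type*} [NormedAddCommGroup E] [NormedSpace ℝ E]
    {EM : Type*} [NormedAddCommGroup EM] [NormedSpace ℝ EM] [FiniteDimensional ℝ EM]
    {M : Type*} [TopologicalSpace M] [ChartedSpace EM M] [T2Space M] [IsManifold 𝓘(ℝ, EM) ∞ M]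
    {S : Set M} [ChartedSpace E S]
    (hS : Manifold.IsSmoothEmbedding 𝓘(ℝ, E) 𝓘(ℝ, EM) ∞ (Subtype.val : S → M)) :
    ofManifold (E := E) S = restrict (ofManifold (E := EM) M) S := by
  ext f
  constructor
  · intro hf x
    obtain ⟨r, V, hV, hxV, hr, hr_inv⟩ := exists_contMDiffOn_leftInverse_of_isImmersionAt
      (hS.isImmersion.isImmersionAt x)
    obtain ⟨F, hF, hFr⟩ := exists_contMDiff_eventuallyEq_of_contMDiffOn
      (ContMDiff.comp_contMDiffOn (g := f) hf hr) (hV.mem_nhds hxV)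
    have hFf : ∀ᶠ y : S in 𝓝 x, f y = F y := by
      filter_upwards [hr_inv, continuousAt_subtype_val.eventually hFr] with y hy hFy
      rw [hFy, Function.comp_apply, hy]
    rw [nhds_subtype_eq_comap, eventually_comap] at hFf
    obtain ⟨U, hUF, hU, hxU⟩ := eventually_nhds_iff.1 hFf
    exact ⟨U, hU, hxU, F, hF, fun y hy => hUF y hy y rfl⟩
  · intro hf x
    obtain ⟨U, hU, hxU, F, hF, hfF⟩ := hf x
    refine (ContMDiff.comp hF hS.contMDiff x).congr_of_eventuallyEq ?_
    filter_upwards [(hU.preimage continuous_subtype_val).mem_nhds hxU] with y hy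
    exact hfF y hy

theorem ofManifold_eq_orbitSpace_of_isSubmersionAt
    {G X : Type*} [Group G] [MulAction G X] [TopologicalSpace X]
    {E : Type*} [NormedAddCommGroup E] [NormedSpace ℝ E] [ChartedSpace E X]
    {E' : Type*} [NormedAddCommGroup E'] [NormedSpace ℝ E']
    [ChartedSpace E' (MulAction.orbitRel.Quotient G X)]
    (hπ : ∀ x : X, Manifold.IsSubmersionAt 𝓘(ℝ, E) 𝓘(ℝ, E') ∞ (orbitMap G) x) :
    ofManifold (E := E') (MulAction.orbitRel.Quotient G X) =
      orbitSpace G (ofManifold (E := E) X) := by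
  ext f
  refine ⟨fun hf => ⟨ContMDiff.continuous hf, ContMDiff.comp hf fun x => (hπ x).contMDiffAt⟩, ?_⟩
  rintro ⟨-, hf⟩ ⟨x⟩
  exact contMDiffAt_of_comp_isSubmersionAt (hπ x) (hf x)

end DifferentialSpace

section ConnectedComponents

open Set Topology

theorem image_connectedComponentIn_preimage_of_isOpenQuotientMap
    {X Y : Type*} [TopologicalSpace X] [TopologicalSpace Y] {π : X → Y}
    (hπ : IsOpenQuotientMap π) (hπ_fib : ∀ y, IsConnected (π ⁻¹' {y})) {S : Set Y} {x : X}
    (hx : π x ∈ S) :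
    π '' connectedComponentIn (π ⁻¹' S) x = connectedComponentIn S (π x) := by
  let πS : π ⁻¹' S → S := S.restrictPreimage π
  have hπS : IsOpenQuotientMap πS :=
    ⟨hπ.surjective.restrictPreimage S, hπ.continuous.restrictPreimage,
      hπ.isOpenMap.restrictPreimage S⟩
  have hπS_fib : ∀ y, IsConnected (πS ⁻¹' {y}) := fun y => by
    have h_fib : Subtype.val '' (πS ⁻¹' {y}) = π ⁻¹' {(y : Y)} := by
      refine Subset.antisymm ?_ fun z hz => ⟨⟨z, show π z ∈ S from hz ▸ y.2⟩, Subtype.ext hz, rfl⟩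
      rintro _ ⟨w, hw, rfl⟩
      exact congrArg Subtype.val hw
    have h_conn := h_fib ▸ hπ_fib y
    exact ⟨h_conn.nonempty.of_image,
      IsInducing.subtypeVal.isPreconnected_image.1 h_conn.isPreconnected⟩
  have h_image : πS '' connectedComponent ⟨x, hx⟩ = connectedComponent ⟨π x, hx⟩ :=
    hπS.isQuotientMap.isCoinducing.image_connectedComponent hπS_fib ⟨x, hx⟩
  rw [connectedComponentIn_eq_image (show x ∈ π ⁻¹' S from hx), connectedComponentIn_eq_image hx,
    ← h_image, image_image, image_image]
  rfl

variable {G X : Type*} [Group G] [MulAction G X]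

theorem preimage_orbitMap_singleton (x : X) :
    orbitMap G ⁻¹' {orbitMap G x} = MulAction.orbit G x :=
  ext fun _ => Quotient.eq

theorem preimage_orbitMap_image {A : Set X} (hA : ∀ (g : G), ∀ x ∈ A, g • x ∈ A) :
    orbitMap G ⁻¹' (orbitMap G '' A) = A := by
  refine (subset_preimage_image _ _).antisymm' ?_
  rintro x ⟨y, hy, hyx⟩
  obtain ⟨g, rfl⟩ : x ∈ MulAction.orbit G y := Quotient.exact hyx.symm
  exact hA g y hy

theorem image_orbitMap_connectedComponentIn [TopologicalSpace G] [ConnectedSpace G]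
    [TopologicalSpace X] [ContinuousSMul G X] {A : Set X}
    (hA : ∀ (g : G), ∀ x ∈ A, g • x ∈ A) {x : X} (hx : x ∈ A) :
    orbitMap G '' connectedComponentIn A x =
      connectedComponentIn (orbitMap G '' A) (orbitMap G x) := by
  have h_fib : ∀ y : MulAction.orbitRel.Quotient G X, IsConnected (orbitMap G ⁻¹' {y}) := by
    rintro ⟨z⟩
    have h_orbit : IsConnected (MulAction.orbit G z) :=
      isConnected_range (continuous_id.smul continuous_const)
    rwa [← preimage_orbitMap_singleton] at h_orbit
  have h_open : IsOpenQuotientMap (orbitMap G : X → MulAction.orbitRel.Quotient G X) :=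
    MulAction.isOpenQuotientMap_quotientMk
  have h_image := image_connectedComponentIn_preimage_of_isOpenQuotientMap h_open h_fib
    (mem_image_of_mem (orbitMap G) hx)
  rwa [preimage_orbitMap_image hA] at h_image

end ConnectedComponents

theorem proposition5p1_general
    (EG : Type*) [NormedAddCommGroup EG] [NormedSpace ℝ EG] [FiniteDimensional ℝ EG]
    {G : Type*} [Group G] [TopologicalSpace G] [ChartedSpace EG G] [T2Space G]
    [LieGroup 𝓘(ℝ, EG) ∞ G]
    (EM : Type*) [NormedAddCommGroup EM] [NormedSpace ℝ EM] [FiniteDimensional ℝ EM]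
    {M : Type*} [TopologicalSpace M] [ChartedSpace EM M] [T2Space M] [IsManifold 𝓘(ℝ, EM) ∞ M]
    [MulAction G M] [ContMDiffSMul 𝓘(ℝ, EG) 𝓘(ℝ, EM) ∞ G M] [ProperSMul G M]
    (P : SubMulAction G M) :
    (∀ [ConnectedSpace G] {A : Set M} {m₀ : M}, (∀ (g : G), ∀ m ∈ A, g • m ∈ A) → m₀ ∈ A →
      (P : Set M) = connectedComponentIn A m₀ →
        orbitMap G '' (P : Set M) = connectedComponentIn (orbitMap G '' A) (orbitMap G m₀)) ∧
    IsDifferentialStructure (orbitSpace G (ofManifold (E := EM) M)) ∧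
    IsDifferentialStructure (orbitSpace G (X := P) (restrict (ofManifold (E := EM) M) P)) ∧
    IsDifferentialStructure
      (restrict (orbitSpace G (ofManifold (E := EM) M)) (orbitMap G '' (P : Set M))) ∧
    ∃ Λ : MulAction.orbitRel.Quotient G P ≃ orbitMap G '' (P : Set M),
      (∀ p : P, (Λ (orbitMap G p) : MulAction.orbitRel.Quotient G M) = orbitMap G (p : M)) ∧
      IsDiffeomorphism (orbitSpace G (X := P) (restrict (ofManifold (E := EM) M) P))
        (restrict (orbitSpace G (ofManifold (E := EM) M)) (orbitMap G '' (P : Set M))) Λ ∧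
      ∀ (E : Type*) [NormedAddCommGroup E] [NormedSpace ℝ E]
        (E' : Type*) [NormedAddCommGroup E'] [NormedSpace ℝ E']
        [ChartedSpace E P] [ChartedSpace E' (MulAction.orbitRel.Quotient G P)],
        Manifold.IsSmoothEmbedding 𝓘(ℝ, E) 𝓘(ℝ, EM) ∞ (Subtype.val : P → M) →
        (∀ p : P, Manifold.IsSubmersionAt 𝓘(ℝ, E) 𝓘(ℝ, E') ∞
          (orbitMap G : P → MulAction.orbitRel.Quotient G P) p) →
        IsDiffeomorphism (ofManifold (E := E') (MulAction.orbitRel.Quotient G P))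
          (restrict (orbitSpace G (ofManifold (E := EM) M)) (orbitMap G '' (P : Set M))) Λ := by
  have : ContinuousSMul G M := ProperSMul.toContinuousSMul
  have hM := isDifferentialStructure_ofManifold (E := EM) M
  have h_avg := hasInvariantAverages_ofManifold G EM M EG
  have hM_cont : ∀ f ∈ ofManifold (E := EM) M, Continuous f := fun _ => hM.continuous
  have hΛ := h_avg.isDiffeomorphism_orbitQuotientEquivImage hM_cont P
  refine ⟨fun hA hm₀ hP => hP ▸ image_orbitMap_connectedComponentIn hA hm₀,
    hM.orbitSpace h_avg, (hM.restrict P).orbitSpace (X := P) (h_avg.restrict hM_cont P),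
    (hM.orbitSpace h_avg).restrict _, orbitQuotientEquivImage P, fun _ => rfl, hΛ, ?_⟩
  intro E _ _ E' _ _ _ _ h_embedding h_submersion
  have hP : ofManifold (E := E) P = restrict (ofManifold (E := EM) M) P :=
    ofManifold_eq_restrict_of_isSmoothEmbedding h_embedding
  rwa [ofManifold_eq_orbitSpace_of_isSubmersionAt h_submersion, hP]

theorem proposition5p1
    {EG : Type*} [NormedAddCommGroup EG] [NormedSpace ℝ EG] [FiniteDimensional ℝ EG]
    {G : Type*} [Group G] [TopologicalSpace G] [ChartedSpace EG G] [T2Space G]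
    [LieGroup 𝓘(ℝ, EG) ∞ G] [ConnectedSpace G]
    {EM : Type*} [NormedAddCommGroup EM] [NormedSpace ℝ EM] [FiniteDimensional ℝ EM]
    {M : Type*} [TopologicalSpace M] [ChartedSpace EM M] [T2Space M] [ParacompactSpace M]
    [IsManifold 𝓘(ℝ, EM) ∞ M]
    [MulAction G M] [ContMDiffSMul 𝓘(ℝ, EG) 𝓘(ℝ, EM) ∞ G M] [ProperSMul G M]
    (H : Subgroup G) (m₀ : M) (hm₀ : m₀ ∈ orbitTypeSet M H) :
    -- `π(P)` is a stratum of `M/G`: a connected component of `π(M_(H))`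
    stratum H m₀ = connectedComponentIn (orbitMap G '' orbitTypeSet M H) (orbitMap G m₀) ∧
    -- `M/G` and `P/G` are differential spaces, and so is `π(P)` as a subset of `M/G`
    IsDifferentialStructure (orbitSpace G (ofManifold (E := EM) M)) ∧
    IsDifferentialStructure
      (orbitSpace G (X := component H m₀) (restrict (ofManifold (E := EM) M) (component H m₀))) ∧
    IsDifferentialStructure
      (restrict (orbitSpace G (ofManifold (E := EM) M)) (stratum H m₀)) ∧
    ∃ Λ : MulAction.orbitRel.Quotient G (component H m₀) ≃ stratum H m₀,
      (∀ p : component H m₀, (Λ (orbitMap G p) : MulAction.orbitRel.Quotient G M)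
        = orbitMap G (p : M)) ∧
      -- `P` as a differential subspace of `M`, `P/G` as its orbit space
      IsDiffeomorphism
        (orbitSpace G (X := component H m₀) (restrict (ofManifold (E := EM) M) (component H m₀)))
        (restrict (orbitSpace G (ofManifold (E := EM) M)) (stratum H m₀)) Λ ∧
      -- `P` as an embedded submanifold of `M`, `P/G` as the quotient manifold of `P`
      ∀ (n k : ℕ)
        [ChartedSpace (EuclideanSpace ℝ (Fin n)) (component H m₀)]
        [IsManifold (𝓡 n) ∞ (component H m₀)]
        [ChartedSpace (EuclideanSpace ℝ (Fin k))
          (MulAction.orbitRel.Quotient G (component H m₀))]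
        [IsManifold (𝓡 k) ∞ (MulAction.orbitRel.Quotient G (component H m₀))],
        Manifold.IsSmoothEmbedding (𝓡 n) 𝓘(ℝ, EM) ∞ (Subtype.val : component H m₀ → M) →
        (∀ p : component H m₀, Manifold.IsSubmersionAt (𝓡 n) (𝓡 k) ∞
          (orbitMap G : component H m₀ → MulAction.orbitRel.Quotient G (component H m₀)) p) →
        IsDiffeomorphism
          (ofManifold (E := EuclideanSpace ℝ (Fin k))
            (MulAction.orbitRel.Quotient G (component H m₀)))
          (restrict (orbitSpace G (ofManifold (E := EM) M)) (stratum H m₀)) Λ := by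
  have : ContinuousSMul G M := ProperSMul.toContinuousSMul
  obtain ⟨h_stratum, hM, hP, hπP, Λ, hΛ, hΛ_diffeo, hΛ_manifold⟩ :=
    proposition5p1_general EG EM (component H m₀)
  exact ⟨h_stratum (fun g _ hm => smul_mem_orbitTypeSet hm g) hm₀ rfl, hM, hP, hπP, Λ, hΛ,
    hΛ_diffeo, fun n k => hΛ_manifold _ _⟩
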